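/- Let $r\ge 1$, let $\alpha_1,\dots,\alpha_r,\beta>-1$ be real with $\alpha_i-\alpha_j\notin\mathbb{Z}$ for $i\neq j$. For $\vec n=(n_1,\dots,n_r)\in\mathbb{N}^r$ (where $0\in\mathbb N$) put $|\vec n|=n_1+\cdots+n_r$, and let $\vec e_j$ be the $j$-th unit vector. There is exactly one monic polynomial $P_{\vec n}$ of degree $|\vec n|$ (the Jacobi–Piñeiro polynomial) with $$\int_0^1 P_{\vec n}(x)\,x^k\,x^{\alpha_j}(1-x)^\beta\,dx=0,\qquad 0\le k\le n_j-1,\ 1\le j\le r,$$ and there are unique real numbers $a_{\vec n,j},b_{\vec n,k}$, with $a_{\vec n,j}=0$ if $n_j=0$, such that $$xP_{\vec n}(x)=P_{\vec n+\vec e_k}(x)+b_{\vec n,k}P_{\vec n}(x)+\sum_{j:\,n_j\ge1}a_{\vec n,j}P_{\vec n-\vec e_j}(x),\qquad k=1,\dots,r.$$ Let $q_r(z)=\prod_{j=1}^r(z-\alpha_j)$, $Q_{r,\vec n}(z)=\prod_{j=1}^r(z-n_j-\alpha_j)$, and let $\delta_{\vec n}$ be the coefficient of $x^{|\vec n|-1}$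 in $P_{\vec n}$ (with $\delta_{\vec 0}=0$). Then, for all $\vec n$ and all $1\le j,k\le r$: 1. $$a_{\vec n,j}=\prod_{i\ne j}\frac{n_j+\alpha_j-\alpha_i}{n_j-n_i+\alpha_j-\alpha_i}\ \prod_{i=1}^r\frac{|\vec n|+\alpha_i+\beta}{|\vec n|+n_i+\alpha_i+\beta}\ \cdot\frac{n_j(n_j+\alpha_j)(|\vec n|+\beta)}{(|\vec n|+n_j+\alpha_j+\beta+1)(|\vec n|+n_j+\alpha_j+\beta)(|\vec n|+n_j+\alpha_j+\beta-1)}.$$ 2. $$\delta_{\vec n}=-(|\vec n|+\beta)\,\frac{q_r(-|\vec n|-\beta)}{Q_{r,\vec n}(-|\vec n|-\beta)}+\beta .$$ 3. $b_{\vec n,k}=\delta_{\vec n}-\delta_{\vec n+\vec e_k}$. 4. With $f(z)=z\,q_r(z)/Q_{r,\vec n}(z)$ and $z_0=-|\vec n|-\beta$, $$\sum_{j=1}^r a_{\vec n,j}=(|\vec n|+\beta)\,\frac{q_r(z_0)}{Q_{r,\vec n}(z_0)}\cdot\left(-\tfrac12\right)\bigl(f(z_0+1)-2f(z_0)+f(z_0-1)\bigr).$$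 The formulas in 1, 2 and 4 hold as written whenever the denominators occurring in them are nonzero. For the exceptional parameters at which a denominator vanishes (this can happen only for $|\vec n|\le2$), the right-hand side is understood as its limit as $\beta'\to\beta$, $\beta'\ne\beta$, where $\beta$ is replaced by $\beta'$ in the formula. -/

import Mathlib

open Polynomial Filter Topology

noncomputable section

namespace JacobiPineiro

/-- The size `|n| = n₁ + ⋯ + n_r` of a multi-index. -/
def size {r : ℕ} (n : Fin r → ℕ) : ℕ := ∑ i, n i

/-- `p` is a type II multiple orthogonal polynomial of multi-index `n` for the weights
`x ^ (α j) * (1 - x) ^ β` on `[0, 1]`: it is monic of degree `|n|`, and orthogonal to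
`x ^ k`, `k < n j`, with respect to the `j`-th weight. -/
structure IsTypeII {r : ℕ} (α : Fin r → ℝ) (β : ℝ) (n : Fin r → ℕ) (p : ℝ[X]) : Prop where
  monic : p.Monic
  natDegree_eq : p.natDegree = size n
  orthogonal : ∀ j : Fin r, ∀ k : ℕ, k < n j →
    ∫ x in (0 : ℝ)..1, p.eval x * x ^ k * (x ^ (α j) * (1 - x) ^ β) = 0

/-- `a = (a_{n,1}, …, a_{n,r})` and `b = (b_{n,1}, …, b_{n,r})` are nearest-neighbor recurrence
coefficients at `n` of the family `P`: for every `k`,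
`x P_n = P_{n + e_k} + b_{n,k} P_n + ∑_j a_{n,j} P_{n - e_j}`.
The terms with `n j = 0`, where `n - e_j` is not a multi-index, are absent, and by convention
`a_{n,j} = 0` for them. -/
structure IsRecurrenceCoeff {r : ℕ} (P : (Fin r → ℕ) → ℝ[X]) (n : Fin r → ℕ)
    (a b : Fin r → ℝ) : Prop where
  boundary : ∀ j, n j = 0 → a j = 0
  recurrence : ∀ k, X * P n = P (n + Pi.single k 1) + C (b k) * P n
    + ∑ j, if n j = 0 then 0 else C (a j) * P (n - Pi.single j 1)

/-- `q_r(x) = ∏_j (x - α_j)`. -/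
def q {r : ℕ} (α : Fin r → ℝ) : ℝ[X] := ∏ j, (X - C (α j))

/-- `Q_{r,n}(x) = ∏_j (x - n_j - α_j)`. -/
def Q {r : ℕ} (α : Fin r → ℝ) (n : Fin r → ℕ) : ℝ[X] := ∏ j, (X - C ((n j : ℝ) + α j))

/-- The quotient `q_r(z) / Q_{r,n}(z)`. -/
def quot {r : ℕ} (α : Fin r → ℝ) (n : Fin r → ℕ) (z : ℝ) : ℝ := (q α).eval z / (Q α n).eval z

/-- The second difference `(Δ∇f)(z) = f(z + 1) - 2 f(z) + f(z - 1)`. -/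
def secondDiff (f : ℝ → ℝ) (z : ℝ) : ℝ := f (z + 1) - 2 * f z + f (z - 1)

/-- The explicit product for `a_{n,j}`. -/
def aFormula {r : ℕ} (α : Fin r → ℝ) (β : ℝ) (n : Fin r → ℕ) (j : Fin r) : ℝ :=
  (∏ i ∈ Finset.univ.erase j, ((n j : ℝ) + α j - α i) / ((n j : ℝ) - n i + α j - α i))
  * (∏ i, ((size n : ℝ) + α i + β) / ((size n : ℝ) + n i + α i + β))
  * ((n j : ℝ) * (n j + α j) * (size n + β)
    / (((size n : ℝ) + n j + α j + β + 1) * ((size n : ℝ) + n j + α j + β)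
      * ((size n : ℝ) + n j + α j + β - 1)))

/-- The explicit expression for `δ_n`. -/
def deltaFormula {r : ℕ} (α : Fin r → ℝ) (β : ℝ) (n : Fin r → ℕ) : ℝ :=
  -((size n : ℝ) + β) * quot α n (-(size n : ℝ) - β) + β

/-- The closed form of `∑_j a_{n,j}`. -/
def sumFormula {r : ℕ} (α : Fin r → ℝ) (β : ℝ) (n : Fin r → ℕ) : ℝ :=
  ((size n : ℝ) + β) * quot α n (-(size n : ℝ) - β)
  * (-(1 / 2) * secondDiff (fun z => z * quot α n z) (-(size n : ℝ) - β))

end JacobiPineiro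

end

noncomputable section
namespace JacobiPineiro

/-! ### Beta integrals -/

/-! Expanding `p` in powers of `1 - x` and using Beta integrals, the moment of a polynomial of
degree at most `N` against `x ^ s * (1 - x) ^ β` is an explicit Gamma quotient times a polynomial in
`s` of degree at most `N`, its `transform` (`moment_eq_transform`). The map `p ↦ transform β N p` is
a bijection on polynomials of degree at most `N`. For `s > -1` the Gamma quotient is positive, so
orthogonality says exactly that the transform vanishes at the points `α j + k`, `k < n j`. These are
`size n` distinct points because no `α i - α j` is an integer. Hence the transform of `P_n` is
`kappa * node`, and monicity fixes `kappa`.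

Everything is read off from this product. The value of the transform near `s = -|n| - β` gives
`δ_n`. A polynomial of degree below `|n|` with all these moments zero is itself zero
(`eq_zero_of_moments`), which yields uniqueness and the recurrence: `b` matches subleading
coefficients, and `a_{n,j}` is the quotient of the moments of `x P_n` and `P_{n - e_j}` at `s = α j
+ n j - 1`. The closed forms follow from the shift identities `eval_node_mul_eval_Q` and
`eval_node_shift`.

The sum of the `a_{n,j}` is a vanishing divided difference of `z q(z)` (`sum_div_prod_sub_mul`).
Exceptional `β` are isolated, and `aCoeff` and `delta` are continuous there, which gives the limit
statements. -/

theorem intervalIntegrable_rpow_mul_one_sub_rpow {s b : ℝ} (hs : -1 < s) (hb : -1 < b) :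
    IntervalIntegrable (fun x : ℝ => x ^ s * (1 - x) ^ b) MeasureTheory.volume 0 1 := by
  have h := Complex.betaIntegral_convergent (u := ((s + 1 : ℝ) : ℂ)) (v := ((b + 1 : ℝ) : ℂ))
    (by simp; linarith) (by simp; linarith)
  rw [intervalIntegrable_iff_integrableOn_Ioc_of_le zero_le_one] at h ⊢
  refine (MeasureTheory.Integrable.re h).congr ?_
  filter_upwards [MeasureTheory.ae_restrict_mem measurableSet_Ioc] with x hx
  have h1 : ((s + 1 : ℝ) : ℂ) - 1 = (s : ℂ) := by push_cast; ring
  have h2 : ((b + 1 : ℝ) : ℂ) - 1 = (b : ℂ) := by push_cast; ring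
  have h3 : (1 : ℂ) - (x : ℂ) = ((1 - x : ℝ) : ℂ) := by push_cast; ring
  simp only [h1, h2, h3]
  rw [← Complex.ofReal_cpow hx.1.le, ← Complex.ofReal_cpow (by linarith [hx.2]),
    ← Complex.ofReal_mul]
  simp

theorem integral_rpow_mul_one_sub_rpow {s b : ℝ} (hs : -1 < s) (hb : -1 < b) :
    ∫ x in (0 : ℝ)..1, x ^ s * (1 - x) ^ b =
      Real.Gamma (s + 1) * Real.Gamma (b + 1) / Real.Gamma (s + b + 2) := by
  have h := ProbabilityTheory.beta_eq_betaIntegralReal (s + 1) (b + 1) (by linarith) (by linarith)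
  have h0 : Complex.betaIntegral ((s + 1 : ℝ) : ℂ) ((b + 1 : ℝ) : ℂ) =
      ((∫ x in (0 : ℝ)..1, x ^ s * (1 - x) ^ b : ℝ) : ℂ) := by
    rw [Complex.betaIntegral, ← intervalIntegral.integral_ofReal]
    refine intervalIntegral.integral_congr fun x hx => ?_
    rw [Set.uIcc_of_le zero_le_one] at hx
    have h1 : ((s + 1 : ℝ) : ℂ) - 1 = (s : ℂ) := by push_cast; ring
    have h2 : ((b + 1 : ℝ) : ℂ) - 1 = (b : ℂ) := by push_cast; ring
    have h3 : (1 : ℂ) - (x : ℂ) = ((1 - x : ℝ) : ℂ) := by push_cast; ring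
    simp only [h1, h2, h3]
    rw [← Complex.ofReal_cpow hx.1, ← Complex.ofReal_cpow (by linarith [hx.2]),
      ← Complex.ofReal_mul]
  rw [h0, Complex.ofReal_re, ProbabilityTheory.beta] at h
  rw [← h]
  congr 2
  ring

theorem Gamma_add_nat_eq_prod {x : ℝ} (hx : 0 < x) (m : ℕ) :
    Real.Gamma (x + m) = (∏ i ∈ Finset.range m, (x + i)) * Real.Gamma x := by
  induction m with
  | zero => simp
  | succ m ih =>
    rw [Finset.prod_range_succ, Nat.cast_succ, ← add_assoc, Real.Gamma_add_one (by positivity), ih]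
    ring

/-! ### The moment functional and its polynomial transform -/

/-- The moment `∫₀¹ p(x) x ^ s (1 - x) ^ β dx`. -/
def moment (β s : ℝ) (p : ℝ[X]) : ℝ := ∫ x in (0 : ℝ)..1, p.eval x * (x ^ s * (1 - x) ^ β)

theorem intervalIntegrable_eval_mul {β s : ℝ} (hβ : -1 < β) (hs : -1 < s) (p : ℝ[X]) :
    IntervalIntegrable (fun x : ℝ => p.eval x * (x ^ s * (1 - x) ^ β)) MeasureTheory.volume 0 1 :=
  (intervalIntegrable_rpow_mul_one_sub_rpow hs hβ).continuousOn_mul p.continuous.continuousOn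

theorem moment_add {β s : ℝ} (hβ : -1 < β) (hs : -1 < s) (p p' : ℝ[X]) :
    moment β s (p + p') = moment β s p + moment β s p' := by
  rw [moment, moment, moment, ← intervalIntegral.integral_add
    (intervalIntegrable_eval_mul hβ hs p) (intervalIntegrable_eval_mul hβ hs p')]
  simp only [eval_add, add_mul]

theorem moment_C_mul (β s c : ℝ) (p : ℝ[X]) :
    moment β s (C c * p) = c * moment β s p := by
  rw [moment, moment, ← intervalIntegral.integral_const_mul]
  simp only [eval_mul, eval_C, mul_assoc]

theorem moment_zero (β s : ℝ) : moment β s 0 = 0 := by simp [moment]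

theorem moment_sub {β s : ℝ} (hβ : -1 < β) (hs : -1 < s) (p p' : ℝ[X]) :
    moment β s (p - p') = moment β s p - moment β s p' := by
  have h := moment_add hβ hs (p - p') p'
  rw [sub_add_cancel] at h
  linarith

theorem moment_sum {β s : ℝ} (hβ : -1 < β) (hs : -1 < s) {ι : Type*} (t : Finset ι)
    (p : ι → ℝ[X]) : moment β s (∑ i ∈ t, p i) = ∑ i ∈ t, moment β s (p i) := by
  classical
  induction t using Finset.induction_on with
  | empty => simp [moment_zero]
  | insert i t hi ih => rw [Finset.sum_insert hi, Finset.sum_insert hi, moment_add hβ hs, ih]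

theorem integral_eval_mul_pow_mul (β a : ℝ) (k : ℕ) (p : ℝ[X]) :
    ∫ x in (0 : ℝ)..1, p.eval x * x ^ k * (x ^ a * (1 - x) ^ β) = moment β (a + k) p := by
  refine intervalIntegral.integral_congr_ae (Eventually.of_forall fun x hx => ?_)
  rw [Set.uIoc_of_le zero_le_one] at hx
  rw [Real.rpow_add hx.1, Real.rpow_natCast]
  ring

theorem moment_X_mul (β s : ℝ) (p : ℝ[X]) : moment β s (X * p) = moment β (s + 1) p := by
  refine intervalIntegral.integral_congr_ae (Eventually.of_forall fun x hx => ?_)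
  rw [Set.uIoc_of_le zero_le_one] at hx
  rw [Real.rpow_add hx.1, Real.rpow_one, eval_mul, eval_X]
  ring

/-- The rising factorial `(β + 1) (β + 2) ⋯ (β + m)`. -/
def rising (β : ℝ) (m : ℕ) : ℝ := ∏ i ∈ Finset.range m, (β + 1 + i)

theorem rising_succ (β : ℝ) (m : ℕ) : rising β (m + 1) = rising β m * (β + 1 + m) :=
  Finset.prod_range_succ _ _

theorem rising_pos {β : ℝ} (hβ : -1 < β) (m : ℕ) : 0 < rising β m :=
  Finset.prod_pos fun i _ => by have : (0 : ℝ) ≤ i := i.cast_nonneg; linarith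

/-- For `p` of degree at most `N`, the polynomial `R` such that the moments of `p` are
`Γ (s + 1) Γ (β + 1) / Γ (s + β + N + 2) * R s`. -/
def transform (β : ℝ) (N : ℕ) (p : ℝ[X]) : ℝ[X] :=
  ∑ m ∈ Finset.range (N + 1), C ((p.comp (1 - X)).coeff m) *
    (C (rising β m) * ∏ i ∈ Finset.Ico m N, (X + C (β + i + 2)))

theorem transform_add (β : ℝ) (N : ℕ) (p p' : ℝ[X]) :
    transform β N (p + p') = transform β N p + transform β N p' := by
  simp only [transform, add_comp, coeff_add, C_add, add_mul, Finset.sum_add_distrib]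

/-- The new factor vanishes at `-(β + N + 2)`, so the value there isolates the top coefficient. The
inductions on `N` and the normalization of `P_n` rest on this. -/
theorem transform_succ (β : ℝ) (N : ℕ) (p : ℝ[X]) :
    transform β (N + 1) p = (X + C (β + N + 2)) * transform β N p +
      C ((p.comp (1 - X)).coeff (N + 1) * rising β (N + 1)) := by
  rw [transform, Finset.sum_range_succ, transform, Finset.mul_sum, Finset.Ico_self,
    Finset.prod_empty, mul_one, C_mul]
  congr 1
  refine Finset.sum_congr rfl fun m hm => ?_
  rw [Finset.prod_Ico_succ_top (Nat.lt_succ_iff.1 (Finset.mem_range.1 hm))]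
  ring

theorem natDegree_transform_le (β : ℝ) (N : ℕ) (p : ℝ[X]) :
    (transform β N p).natDegree ≤ N := by
  induction N with
  | zero => simp [transform, ← C_mul, -map_mul]
  | succ N ih =>
    rw [transform_succ]
    refine (natDegree_add_le _ _).trans (max_le ?_ (by simp only [natDegree_C, zero_le]))
    refine natDegree_mul_le.trans ?_
    rw [natDegree_X_add_C]
    omega

theorem moment_eq_transform {β s : ℝ} (hβ : -1 < β) (hs : -1 < s) {N : ℕ} {p : ℝ[X]}
    (hp : p.natDegree ≤ N) :
    moment β s p = Real.Gamma (s + 1) * Real.Gamma (β + 1) / Real.Gamma (s + β + N + 2) *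
      (transform β N p).eval s := by
  have hc : (p.comp (1 - X)).natDegree < N + 1 := by
    refine Nat.lt_succ_of_le (natDegree_comp_le.trans ?_)
    have : (1 - X : ℝ[X]).natDegree ≤ 1 := by compute_degree
    nlinarith
  have hpe : p = ∑ m ∈ Finset.range (N + 1), C ((p.comp (1 - X)).coeff m) * (1 - X) ^ m := by
    have h1 : p = (p.comp (1 - X)).comp (1 - X) := by simp [comp_assoc]
    conv_lhs => rw [h1, as_sum_range_C_mul_X_pow' _ hc]
    simp
  have hm (m : ℕ) : moment β s ((1 - X) ^ m) =
      Real.Gamma (s + 1) * Real.Gamma (β + m + 1) / Real.Gamma (s + β + m + 2) := by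
    have hm0 : (0 : ℝ) ≤ m := m.cast_nonneg
    have h := integral_rpow_mul_one_sub_rpow hs (b := β + m) (by linarith)
    rw [← add_assoc] at h
    rw [← h, moment]
    refine intervalIntegral.integral_congr_ae ?_
    -- Splitting `(1 - x) ^ (β + m)` needs a positive base, so the endpoint `1` is discarded.
    have hne : ∀ᵐ x : ℝ, x ≠ 1 := by simp [MeasureTheory.ae_iff]
    filter_upwards [hne] with x hx1 hx
    rw [Set.uIoc_of_le zero_le_one] at hx
    rw [Real.rpow_add (by have := lt_of_le_of_ne hx.2 hx1; linarith), Real.rpow_natCast]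
    simp
    ring
  conv_lhs => rw [hpe]
  rw [moment_sum hβ hs, transform, eval_finsetSum, Finset.mul_sum]
  refine Finset.sum_congr rfl fun m hmN => ?_
  obtain ⟨k, rfl⟩ := Nat.exists_eq_add_of_le (Nat.lt_succ_iff.1 (Finset.mem_range.1 hmN))
  have hm0 : (0 : ℝ) ≤ m := m.cast_nonneg
  have hx : 0 < s + β + m + 2 := by linarith
  have hG1 := Gamma_add_nat_eq_prod (x := β + 1) (by linarith) m
  have hG2 := Gamma_add_nat_eq_prod hx k
  -- All terms are brought to the denominator `Γ (s + β + N + 2)`; the factors `i = m, …, N - 1` of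
  -- the transform compensate.
  have e1 : β + m + 1 = β + 1 + m := by ring
  have e2 : s + β + ((m + k : ℕ) : ℝ) + 2 = s + β + m + 2 + k := by push_cast; ring
  have e3 : (∏ i ∈ Finset.Ico m (m + k), (X + C (β + i + 2))).eval s =
      ∏ i ∈ Finset.range k, (s + β + m + 2 + i) := by
    rw [Finset.prod_Ico_eq_prod_range, eval_prod, Nat.add_sub_cancel_left]
    refine Finset.prod_congr rfl fun i _ => ?_
    simp
    ring
  have hpos : (∏ i ∈ Finset.range k, (s + β + m + 2 + (i : ℝ))) ≠ 0 :=
    (Finset.prod_pos fun i _ => by positivity).ne'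
  have hΓ := (Real.Gamma_pos_of_pos hx).ne'
  rw [moment_C_mul, hm, e1, e2, hG1, hG2, eval_mul, eval_mul, eval_C, eval_C, e3, rising]
  field_simp

/-- The coefficients of `p (1 - X)` are signed Hasse derivatives of `p` at `1`. `K` bounds the
number of terms: 0 above the degree, 1 at the top coefficient, 2 just below it. -/
theorem coeff_comp_one_sub_X {p : ℝ[X]} {m K : ℕ} (hp : p.natDegree < m + K) :
    (p.comp (1 - X)).coeff m =
      (-1) ^ m * ∑ k ∈ Finset.range K, ((k + m).choose m : ℝ) * p.coeff (k + m) := by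
  have h : p.comp (1 - X) = (taylor 1 p).comp (C (-1) * X) := by
    rw [taylor_apply, comp_assoc]
    congr 1
    simp
    ring
  rw [h, comp_C_mul_X_coeff, taylor_coeff, mul_comm]
  congr 1
  rcases Nat.eq_zero_or_pos K with rfl | hK
  · rw [hasseDeriv_eq_zero_of_lt_natDegree _ _ (by simpa using hp)]
    simp
  rw [eval_eq_sum_range' (n := K)]
  · simp [hasseDeriv_coeff]
  · have := natDegree_hasseDeriv_le p m
    omega

theorem eq_zero_of_transform_eq_zero {β : ℝ} (hβ : -1 < β) {N : ℕ} {p : ℝ[X]}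
    (hp : p.natDegree ≤ N) (h : transform β N p = 0) : p = 0 := by
  induction N with
  | zero =>
    obtain ⟨c, rfl⟩ := natDegree_eq_zero.1 (Nat.le_zero.1 hp)
    simpa [transform, rising] using h
  | succ N ih =>
    rw [transform_succ] at h
    have h1 := congrArg (eval (-(β + N + 2))) h
    simp only [eval_add, eval_mul, eval_X, eval_C, neg_add_cancel, zero_mul, zero_add, eval_zero,
      mul_eq_zero, (rising_pos hβ (N + 1)).ne', or_false] at h1
    rw [h1, zero_mul, C_0, add_zero] at h
    refine ih ?_ ((mul_eq_zero.1 h).resolve_left (X_add_C_ne_zero _))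
    rw [coeff_comp_one_sub_X (K := 1) (by omega)] at h1
    simp at h1
    exact natDegree_le_pred hp h1

theorem exists_transform_eq {β : ℝ} (hβ : -1 < β) {N : ℕ} {R : ℝ[X]} (hR : R.natDegree ≤ N) :
    ∃ p : ℝ[X], p.natDegree ≤ N ∧ transform β N p = R := by
  induction N generalizing R with
  | zero =>
    refine ⟨R, hR, ?_⟩
    obtain ⟨c, rfl⟩ := natDegree_eq_zero.1 (Nat.le_zero.1 hR)
    simp [transform, rising]
  | succ N ih =>
    -- `a` is the root of the factor in `transform_succ`. The quotient of `R` by `X - a` is a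
    -- transform by induction; the remainder comes from a multiple of `(1 - X) ^ (N + 1)`.
    set a : ℝ := -(β + N + 2) with ha
    obtain ⟨p, hp, hpR⟩ := ih (R := R /ₘ (X - C a)) (by
      rw [natDegree_divByMonic _ (monic_X_sub_C a), natDegree_X_sub_C]; omega)
    have hd : (1 - X : ℝ[X]).natDegree ≤ 1 := by compute_degree
    have hc : ((C (R.eval a / rising β (N + 1)) * (1 - X) ^ (N + 1)).comp (1 - X)) =
        C (R.eval a / rising β (N + 1)) * X ^ (N + 1) := by simp
    refine ⟨p + C (R.eval a / rising β (N + 1)) * (1 - X) ^ (N + 1), ?_, ?_⟩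
    · refine (natDegree_add_le _ _).trans (max_le (hp.trans N.le_succ) ?_)
      refine (natDegree_C_mul_le _ _).trans (natDegree_pow_le.trans ?_)
      nlinarith
    · have h0 : transform β N (C (R.eval a / rising β (N + 1)) * (1 - X) ^ (N + 1)) = 0 := by
        rw [transform, hc]
        refine Finset.sum_eq_zero fun m hm => ?_
        rw [coeff_C_mul, coeff_X_pow, if_neg (Finset.mem_range.1 hm).ne]
        simp
      have h1 : (p.comp (1 - X)).coeff (N + 1) = 0 := by
        rw [coeff_comp_one_sub_X (K := 0) (by omega)]
        simp
      have h2 := modByMonic_add_div R (X - C a)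
      rw [modByMonic_X_sub_C_eq_C_eval] at h2
      rw [transform_succ, transform_add, hpR, h0, add_comp, coeff_add, h1, hc, coeff_C_mul,
        coeff_X_pow_self, zero_add, mul_one, div_mul_cancel₀ _ (rising_pos hβ _).ne', add_zero]
      conv_rhs => rw [← h2]
      rw [ha, C_neg, sub_neg_eq_add]
      ring

/-! ### Multi-indices and node polynomials -/

theorem size_add_single {r : ℕ} (n : Fin r → ℕ) (j : Fin r) :
    size (n + Pi.single j 1) = size n + 1 := by
  simp [size, Finset.sum_add_distrib]

theorem exists_eq_add_single {r : ℕ} {n : Fin r → ℕ} {j : Fin r} (h : n j ≠ 0) :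
    ∃ m : Fin r → ℕ, n = m + Pi.single j 1 := by
  refine ⟨n - Pi.single j 1, (tsub_add_cancel_of_le fun i => ?_).symm⟩
  rcases eq_or_ne i j with rfl | hij
  · simpa using Nat.one_le_iff_ne_zero.2 h
  · simp [hij]

theorem le_size {r : ℕ} (n : Fin r → ℕ) (j : Fin r) : n j ≤ size n :=
  Finset.single_le_sum (f := n) (fun _ _ => Nat.zero_le _) (Finset.mem_univ j)

/-- The falling factorial `x (x - 1) ⋯ (x - m + 1)`. -/
def falling (x : ℝ) (m : ℕ) : ℝ := ∏ k ∈ Finset.range m, (x - k)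

theorem falling_succ (x : ℝ) (m : ℕ) : falling x (m + 1) = falling x m * (x - m) :=
  Finset.prod_range_succ _ _

theorem falling_succ' (x : ℝ) (m : ℕ) : falling x (m + 1) = x * falling (x - 1) m := by
  rw [falling, Finset.prod_range_succ', falling, mul_comm]
  congr 1
  · simp
  · exact Finset.prod_congr rfl fun k _ => by push_cast; ring

theorem falling_mul_sub (x : ℝ) (m : ℕ) : falling x m * (x - m) = x * falling (x - 1) m := by
  rw [← falling_succ, falling_succ']

/-- The monic polynomial with the simple zeros `α j + k`, `k < n j`. -/
def node {r : ℕ} (α : Fin r → ℝ) (n : Fin r → ℕ) : ℝ[X] :=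
  ∏ j, ∏ k ∈ Finset.range (n j), (X - C (α j + k))

theorem eval_node {r : ℕ} (α : Fin r → ℝ) (n : Fin r → ℕ) (s : ℝ) :
    (node α n).eval s = ∏ j, falling (s - α j) (n j) := by
  simp [node, falling, eval_prod, sub_sub]

theorem natDegree_node {r : ℕ} (α : Fin r → ℝ) (n : Fin r → ℕ) :
    (node α n).natDegree = size n := by
  rw [node, natDegree_prod_of_monic _ _ fun j _ => monic_prod_X_sub_C _ _]
  simp only [natDegree_finsetProd_X_sub_C_eq_card, size, Finset.card_range]

theorem node_add_single {r : ℕ} (α : Fin r → ℝ) (n : Fin r → ℕ) (j : Fin r) :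
    node α (n + Pi.single j 1) = node α n * (X - C (α j + n j)) := by
  rw [node, node, ← Finset.mul_prod_erase _ _ (Finset.mem_univ j),
    ← Finset.mul_prod_erase Finset.univ _ (Finset.mem_univ j)]
  have h : ∀ i ∈ Finset.univ.erase j, ∏ k ∈ Finset.range ((n + Pi.single j 1 : Fin r → ℕ) i),
      (X - C (α i + k)) = ∏ k ∈ Finset.range (n i), (X - C (α i + k)) := fun i hi => by
    simp [Finset.ne_of_mem_erase hi]
  rw [Finset.prod_congr rfl h]
  simp only [Pi.add_apply, Pi.single_eq_same, Finset.prod_range_succ]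
  ring

theorem eval_node_self {r : ℕ} (α : Fin r → ℝ) (n : Fin r → ℕ) {j : Fin r} {k : ℕ}
    (hk : k < n j) : (node α n).eval (α j + k) = 0 := by
  rw [eval_node, Finset.prod_eq_zero (Finset.mem_univ j)]
  exact Finset.prod_eq_zero (Finset.mem_range.2 hk) (by ring)

/-- Shifting the argument of the node polynomial by one multiplies it by `Q / q`. -/
theorem eval_node_mul_eval_Q {r : ℕ} (α : Fin r → ℝ) (n : Fin r → ℕ) (z : ℝ) :
    (node α n).eval z * (Q α n).eval z = (q α).eval z * (node α n).eval (z - 1) := by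
  simp only [eval_node, Q, q, eval_prod, ← Finset.prod_mul_distrib, eval_sub, eval_X, eval_C]
  refine Finset.prod_congr rfl fun j _ => ?_
  have h := falling_mul_sub (z - α j) (n j)
  rw [show z - 1 - α j = z - α j - 1 by ring, ← h]
  ring

/-- Argument and `j`-th index move together: for `i ≠ j` apply `falling_mul_sub`, while the `j`-th
factor goes from `m_j!` to `(m_j + 1)!`. This produces the product over `i ≠ j` in `aFormula`. -/
theorem eval_node_shift {r : ℕ} (α : Fin r → ℝ) (m : Fin r → ℕ) (j : Fin r) :
    (node α (m + Pi.single j 1)).eval (α j + m j + 1) *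
        ∏ i ∈ Finset.univ.erase j, ((m j : ℝ) + 1 - m i + α j - α i) =
      (m j + 1) * (∏ i ∈ Finset.univ.erase j, ((m j : ℝ) + 1 + α j - α i)) *
        (node α m).eval (α j + m j) := by
  rw [eval_node, eval_node, ← Finset.mul_prod_erase _ _ (Finset.mem_univ j),
    ← Finset.mul_prod_erase Finset.univ (fun i => falling (α j + m j - α i) (m i))
      (Finset.mem_univ j)]
  have h : ∀ i ∈ Finset.univ.erase j,
      falling (α j + m j + 1 - α i) ((m + Pi.single j 1 : Fin r → ℕ) i) *
        ((m j : ℝ) + 1 - m i + α j - α i) =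
      ((m j : ℝ) + 1 + α j - α i) * falling (α j + m j - α i) (m i) := fun i hi => by
    have h1 := falling_mul_sub (α j + m j + 1 - α i) (m i)
    rw [show α j + m j + 1 - α i - 1 = α j + m j - α i by ring] at h1
    simp only [Pi.add_apply, Pi.single_eq_of_ne (Finset.ne_of_mem_erase hi), add_zero]
    linear_combination h1
  have h2 := Finset.prod_congr rfl h
  rw [Finset.prod_mul_distrib, Finset.prod_mul_distrib] at h2
  have h3 := falling_succ' (m j + 1) (m j)
  rw [add_sub_cancel_right] at h3
  rw [show α j + m j + 1 - α j = (m j : ℝ) + 1 by ring,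
    show α j + m j - α j = (m j : ℝ) by ring]
  simp only [Pi.add_apply, Pi.single_eq_same] at h2 ⊢
  rw [h3]
  linear_combination ((m j : ℝ) + 1) * falling (m j) (m j) * h2

/-- All zeros of the node polynomial exceed `-1`. If there is one, then `|n| ≥ 1` and the evaluation
point lies below `-1`. -/
theorem eval_node_ne_zero {r : ℕ} {α : Fin r → ℝ} {β : ℝ} (hα : ∀ j, -1 < α j) (hβ : -1 < β)
    (n : Fin r → ℕ) : (node α n).eval (-(size n : ℝ) - β - 1) ≠ 0 := by
  rw [eval_node]
  refine Finset.prod_ne_zero_iff.2 fun j _ => Finset.prod_ne_zero_iff.2 fun k hk => ?_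
  have h1 : (1 : ℝ) ≤ size n := by
    have := le_size n j
    have := Finset.mem_range.1 hk
    exact_mod_cast (by omega : 1 ≤ size n)
  have h2 : (0 : ℝ) ≤ k := k.cast_nonneg
  have := hα j
  exact ne_of_lt (by linarith)

theorem add_natCast_ne {r : ℕ} {α : Fin r → ℝ} (hαα : ∀ i j, i ≠ j → ∀ m : ℤ, α i - α j ≠ (m : ℝ))
    {i j : Fin r} (hij : i ≠ j) (k l : ℕ) : α i + k ≠ α j + l := fun h =>
  hαα i j hij (l - k) (by push_cast; linarith)

theorem eval_node_add_ne_zero {r : ℕ} {α : Fin r → ℝ}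
    (hαα : ∀ i j, i ≠ j → ∀ m : ℤ, α i - α j ≠ (m : ℝ)) (m : Fin r → ℕ) (j : Fin r) :
    (node α m).eval (α j + m j) ≠ 0 := by
  rw [eval_node]
  refine Finset.prod_ne_zero_iff.2 fun i _ => Finset.prod_ne_zero_iff.2 fun k hk => ?_
  rcases eq_or_ne i j with rfl | hij
  · have : (k : ℝ) < m i := Nat.cast_lt.2 (Finset.mem_range.1 hk)
    exact ne_of_gt (by linarith)
  · have := add_natCast_ne hαα hij k (m j)
    intro h
    exact this (by linarith)

theorem eq_zero_of_eval_nodes {r : ℕ} {α : Fin r → ℝ}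
    (hαα : ∀ i j, i ≠ j → ∀ m : ℤ, α i - α j ≠ (m : ℝ)) {n : Fin r → ℕ} {R : ℝ[X]}
    (hR : R.natDegree < size n) (h : ∀ j, ∀ k < n j, R.eval (α j + k) = 0) : R = 0 := by
  refine eq_zero_of_natDegree_lt_card_of_eval_eq_zero R
    (f := fun x : Σ j, Fin (n j) => α x.1 + (x.2 : ℕ)) ?_ (fun x => h _ _ x.2.2)
    (by simpa [size] using hR)
  rintro ⟨i, k⟩ ⟨j, l⟩ hkl
  rcases eq_or_ne i j with rfl | hij
  · have : (k : ℕ) = l := by exact_mod_cast (add_left_cancel hkl : ((k : ℕ) : ℝ) = (l : ℕ))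
    simp [Fin.ext this]
  · exact absurd hkl (add_natCast_ne hαα hij _ _)

/-! ### Type II polynomials -/

theorem neg_one_lt_add_natCast {a : ℝ} (ha : -1 < a) (k : ℕ) : -1 < a + k := by
  have : (0 : ℝ) ≤ k := k.cast_nonneg
  linarith

theorem eq_zero_of_moments {r : ℕ} {α : Fin r → ℝ} {β : ℝ} (hα : ∀ j, -1 < α j) (hβ : -1 < β)
    (hαα : ∀ i j, i ≠ j → ∀ m : ℤ, α i - α j ≠ (m : ℝ)) {n : Fin r → ℕ} {p : ℝ[X]}
    (hp : p.degree < size n) (h : ∀ j, ∀ k < n j, moment β (α j + k) p = 0) : p = 0 := by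
  by_contra hp0
  have hd := (natDegree_lt_iff_degree_lt hp0).2 hp
  refine hp0 (eq_zero_of_transform_eq_zero hβ le_rfl
    (eq_zero_of_eval_nodes hαα ((natDegree_transform_le _ _ _).trans_lt hd) fun j k hk => ?_))
  have hs := neg_one_lt_add_natCast (hα j) k
  have h1 := h j k hk
  rw [moment_eq_transform hβ hs le_rfl] at h1
  refine (mul_eq_zero.1 h1).resolve_left ?_
  have h0 : (0 : ℝ) ≤ p.natDegree := Nat.cast_nonneg _
  exact (div_pos (mul_pos (Real.Gamma_pos_of_pos (by linarith)) (Real.Gamma_pos_of_pos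
    (by linarith))) (Real.Gamma_pos_of_pos (by linarith))).ne'

/-- The constant by which the transform of the type II polynomial differs from the node
polynomial. -/
def kappa {r : ℕ} (α : Fin r → ℝ) (β : ℝ) (n : Fin r → ℕ) : ℝ :=
  (-1) ^ size n * rising β (size n) / (node α n).eval (-(size n : ℝ) - β - 1)

theorem kappa_ne_zero {r : ℕ} {α : Fin r → ℝ} {β : ℝ} (hα : ∀ j, -1 < α j) (hβ : -1 < β)
    (n : Fin r → ℕ) : kappa α β n ≠ 0 :=
  div_ne_zero (mul_ne_zero (pow_ne_zero _ (by norm_num)) (rising_pos hβ _).ne')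
    (eval_node_ne_zero hα hβ n)

/-- Every term of the transform with `m < N` contains the factor `X + β + N + 1`, which vanishes
here. -/
theorem eval_transform_neg (β : ℝ) (N : ℕ) (p : ℝ[X]) :
    (transform β N p).eval (-(N : ℝ) - β - 1) = (p.comp (1 - X)).coeff N * rising β N := by
  cases N with
  | zero => simp [transform]
  | succ N =>
    rw [transform_succ]
    simp only [eval_add, eval_mul, eval_X, eval_C]
    push_cast
    ring

theorem exists_isTypeII {r : ℕ} {α : Fin r → ℝ} {β : ℝ} (hα : ∀ j, -1 < α j) (hβ : -1 < β)
    (n : Fin r → ℕ) :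
    ∃ p, IsTypeII α β n p ∧ transform β (size n) p = C (kappa α β n) * node α n := by
  obtain ⟨p, hp, hpt⟩ := exists_transform_eq hβ (N := size n)
    (R := C (kappa α β n) * node α n) ((natDegree_C_mul_le _ _).trans (natDegree_node α n).le)
  have hc : p.coeff (size n) = 1 := by
    have h := eval_transform_neg β (size n) p
    rw [hpt, coeff_comp_one_sub_X (K := 1) (by omega), eval_mul, eval_C, kappa,
      div_mul_cancel₀ _ (eval_node_ne_zero hα hβ n)] at h
    have h1 := mul_right_cancel₀ (rising_pos hβ _).ne' h
    simpa using h1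
  refine ⟨p, ⟨monic_of_natDegree_le_of_coeff_eq_one _ hp hc,
    natDegree_eq_of_le_of_coeff_ne_zero hp (by rw [hc]; exact one_ne_zero), fun j k hk => ?_⟩, hpt⟩
  rw [integral_eval_mul_pow_mul, moment_eq_transform hβ (neg_one_lt_add_natCast (hα j) k) hp, hpt,
    eval_mul, eval_node_self α n hk, mul_zero, mul_zero]

theorem IsTypeII.moment_eq_zero {r : ℕ} {α : Fin r → ℝ} {β : ℝ} {n : Fin r → ℕ} {p : ℝ[X]}
    (h : IsTypeII α β n p) {j : Fin r} {k : ℕ} (hk : k < n j) : moment β (α j + k) p = 0 := by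
  rw [← integral_eval_mul_pow_mul]
  exact h.orthogonal j k hk

theorem IsTypeII.unique {r : ℕ} {α : Fin r → ℝ} {β : ℝ} (hα : ∀ j, -1 < α j) (hβ : -1 < β)
    (hαα : ∀ i j, i ≠ j → ∀ m : ℤ, α i - α j ≠ (m : ℝ)) {n : Fin r → ℕ} {p p' : ℝ[X]}
    (h : IsTypeII α β n p) (h' : IsTypeII α β n p') : p = p' := by
  refine sub_eq_zero.1 (eq_zero_of_moments hα hβ hαα (n := n) ?_ fun j k hk => ?_)
  · have hd : p.degree = size n := by rw [degree_eq_natDegree h.monic.ne_zero, h.natDegree_eq]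
    have hd' : p'.degree = size n := by rw [degree_eq_natDegree h'.monic.ne_zero, h'.natDegree_eq]
    rw [← hd]
    exact degree_sub_lt_left (hd.trans hd'.symm) h.monic.ne_zero
      (h.monic.leadingCoeff.trans h'.monic.leadingCoeff.symm)
  · rw [moment_sub hβ (neg_one_lt_add_natCast (hα j) k), h.moment_eq_zero hk, h'.moment_eq_zero hk,
      sub_zero]

/-- The Jacobi–Piñeiro polynomial of multi-index `n`. -/
def poly {r : ℕ} {α : Fin r → ℝ} {β : ℝ} (hα : ∀ j, -1 < α j) (hβ : -1 < β) (n : Fin r → ℕ) :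
    ℝ[X] := (exists_isTypeII hα hβ n).choose

section poly

variable {r : ℕ} {α : Fin r → ℝ} {β : ℝ} (hα : ∀ j, -1 < α j) (hβ : -1 < β)

theorem isTypeII_poly (n : Fin r → ℕ) : IsTypeII α β n (poly hα hβ n) :=
  (exists_isTypeII hα hβ n).choose_spec.1

theorem transform_poly (n : Fin r → ℕ) :
    transform β (size n) (poly hα hβ n) = C (kappa α β n) * node α n :=
  (exists_isTypeII hα hβ n).choose_spec.2

theorem coeff_poly_size (n : Fin r → ℕ) : (poly hα hβ n).coeff (size n) = 1 := by
  rw [← (isTypeII_poly hα hβ n).natDegree_eq]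
  exact (isTypeII_poly hα hβ n).monic

theorem coeff_poly_of_lt {n : Fin r → ℕ} {m : ℕ} (h : size n < m) :
    (poly hα hβ n).coeff m = 0 :=
  coeff_eq_zero_of_natDegree_lt (by rwa [(isTypeII_poly hα hβ n).natDegree_eq])

theorem moment_poly (n : Fin r → ℕ) {s : ℝ} (hs : -1 < s) :
    moment β s (poly hα hβ n) =
      Real.Gamma (s + 1) * Real.Gamma (β + 1) / Real.Gamma (s + β + size n + 2) *
        (kappa α β n * (node α n).eval s) := by
  rw [moment_eq_transform hβ hs (isTypeII_poly hα hβ n).natDegree_eq.le, transform_poly, eval_mul,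
    eval_C]

/-! ### The subleading coefficient -/

/-- The subleading coefficient, in a form without exceptional parameters. -/
def delta {r : ℕ} (α : Fin r → ℝ) (β : ℝ) (n : Fin r → ℕ) : ℝ :=
  -((size n : ℝ) + β) * ((node α n).eval (-(size n : ℝ) - β) /
    (node α n).eval (-(size n : ℝ) - β - 1)) + β

theorem nextCoeff_poly (n : Fin r → ℕ) : (poly hα hβ n).nextCoeff = delta α β n := by
  have hdeg := (isTypeII_poly hα hβ n).natDegree_eq
  have hK := eval_node_ne_zero hα hβ n
  rcases hN : size n with _ | M
  -- `nextCoeff` is `0` for constants, and `delta` reduces to `-β + β`.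
  · have hn : n = 0 := by
      funext j
      have := le_size n j
      simp
      omega
    have : (poly hα hβ n).natDegree = 0 := hdeg.trans hN
    rw [nextCoeff, if_pos this, delta, hN, hn]
    simp [node]
  · rw [nextCoeff_of_natDegree_pos (by omega), hdeg, hN, Nat.add_sub_cancel]
    have h1 := eval_transform_neg β M (poly hα hβ n)
    have h2 := transform_succ β M (poly hα hβ n)
    have h3 := transform_poly hα hβ n
    have hc := coeff_poly_size hα hβ n
    rw [hN] at h3 hc
    rw [h3] at h2
    -- At this point `X + β + M + 2` equals `1`, and by `h1` the transform of order `M` reveals the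
    -- coefficient of `(1 - x) ^ M`, which involves only the two leading coefficients of `P_n`.
    have h4 := congrArg (eval (-((M : ℝ) + 1) - β)) h2
    rw [coeff_comp_one_sub_X (K := 1) (by omega)] at h4
    rw [coeff_comp_one_sub_X (K := 2) (by omega)] at h1
    simp only [Finset.sum_range_succ, Finset.range_zero, Finset.sum_empty, zero_add,
      Nat.choose_self, Nat.add_comm 1 M, hc, Nat.choose_succ_self_right] at h1 h4
    simp only [eval_add, eval_mul, eval_X, eval_C, rising_succ] at h4
    rw [show -((M : ℝ) + 1) - β = -(M : ℝ) - β - 1 by ring, h1] at h4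
    have hr := (rising_pos hβ M).ne'
    rw [kappa, hN, rising_succ] at h4
    rw [hN] at hK
    rw [delta, hN]
    push_cast at h4 hK ⊢
    rw [show -((M : ℝ) + 1) - β = -(M : ℝ) - β - 1 by ring] at h4 hK ⊢
    set A := (node α n).eval (-(M : ℝ) - β - 1)
    set B := (node α n).eval (-(M : ℝ) - β - 1 - 1)
    have hs : ((-1 : ℝ)) ^ M ≠ 0 := pow_ne_zero _ (by norm_num)
    have h5 : ((-1 : ℝ)) ^ M * rising β M * (coeff (poly hα hβ n) M) =
        (-1) ^ M * rising β M * (-((M : ℝ) + 1 + β) * (A / B) + β) := by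
      rw [pow_succ] at h4
      linear_combination -h4
    exact mul_left_cancel₀ (mul_ne_zero hs hr) h5

end poly

theorem delta_eq_deltaFormula {r : ℕ} {α : Fin r → ℝ} {β : ℝ} (hα : ∀ j, -1 < α j) (hβ : -1 < β)
    {n : Fin r → ℕ} (hQ : (Q α n).eval (-(size n : ℝ) - β) ≠ 0) :
    delta α β n = deltaFormula α β n := by
  have h := eval_node_mul_eval_Q α n (-(size n : ℝ) - β)
  rw [delta, deltaFormula, quot, (div_eq_div_iff (eval_node_ne_zero hα hβ n) hQ).2 h]

/-! ### The recurrence coefficients -/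

/-- The coefficient `a_{n,j}`, in a form without exceptional parameters. -/
def aCoeff {r : ℕ} (α : Fin r → ℝ) (β : ℝ) (n : Fin r → ℕ) (j : Fin r) : ℝ :=
  if n j = 0 then 0 else
    kappa α β n / kappa α β (n - Pi.single j 1) *
      ((node α n).eval (α j + n j) / (node α (n - Pi.single j 1)).eval (α j + n j - 1)) *
      ((α j + n j) / (((size n : ℝ) + n j + α j + β) * ((size n : ℝ) + n j + α j + β + 1)))

theorem aCoeff_add_single {r : ℕ} (α : Fin r → ℝ) (β : ℝ) (m : Fin r → ℕ) (j : Fin r) :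
    aCoeff α β (m + Pi.single j 1) j =
      kappa α β (m + Pi.single j 1) / kappa α β m *
        ((node α (m + Pi.single j 1)).eval (α j + m j + 1) / (node α m).eval (α j + m j)) *
        ((α j + m j + 1) /
          (((size m : ℝ) + m j + α j + β + 2) * ((size m : ℝ) + m j + α j + β + 3))) := by
  rw [aCoeff, if_neg (by simp), add_tsub_cancel_right, size_add_single]
  simp only [Pi.add_apply, Pi.single_eq_same]
  push_cast
  rw [show α j + ((m j : ℝ) + 1) - 1 = α j + m j by ring,
    show α j + ((m j : ℝ) + 1) = α j + m j + 1 by ring,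
    show (size m : ℝ) + 1 + ((m j : ℝ) + 1) + α j + β = size m + m j + α j + β + 2 by ring,
    show (size m : ℝ) + m j + α j + β + 2 + 1 = size m + m j + α j + β + 3 by ring]

section recurrence

variable {r : ℕ} {α : Fin r → ℝ} {β : ℝ} (hα : ∀ j, -1 < α j) (hβ : -1 < β)

theorem moment_poly_ne_zero
    (hαα : ∀ i j, i ≠ j → ∀ m : ℤ, α i - α j ≠ (m : ℝ))
    (m : Fin r → ℕ) (j : Fin r) :
    moment β (α j + m j) (poly hα hβ m) ≠ 0 := by
  have hs := neg_one_lt_add_natCast (hα j) (m j)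
  have h0 : (0 : ℝ) ≤ size m := Nat.cast_nonneg _
  rw [moment_poly hα hβ m hs]
  exact mul_ne_zero (div_pos (mul_pos (Real.Gamma_pos_of_pos (by linarith)) (Real.Gamma_pos_of_pos
    (by linarith))) (Real.Gamma_pos_of_pos (by linarith))).ne'
    (mul_ne_zero (kappa_ne_zero hα hβ m) (eval_node_add_ne_zero hαα m j))

theorem moment_poly_add_single
    (hαα : ∀ i j, i ≠ j → ∀ m : ℤ, α i - α j ≠ (m : ℝ))
    (m : Fin r → ℕ) (j : Fin r) :
    moment β (α j + m j + 1) (poly hα hβ (m + Pi.single j 1)) =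
      aCoeff α β (m + Pi.single j 1) j * moment β (α j + m j) (poly hα hβ m) := by
  have hs := neg_one_lt_add_natCast (hα j) (m j)
  have h0 : (0 : ℝ) ≤ size m := Nat.cast_nonneg _
  have hx : 0 < α j + m j + β + size m + 2 := by linarith
  rw [moment_poly hα hβ _ hs, moment_poly hα hβ _ (by linarith), aCoeff_add_single,
    size_add_single]
  have hk := kappa_ne_zero hα hβ m
  have hn := eval_node_add_ne_zero hαα m j
  have g1 : Real.Gamma (α j + m j + 1 + 1) = (α j + m j + 1) * Real.Gamma (α j + m j + 1) :=
    Real.Gamma_add_one (by linarith)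
  have g2 : Real.Gamma (α j + m j + 1 + β + ((size m + 1 : ℕ) : ℝ) + 2) =
      ((size m : ℝ) + m j + α j + β + 3) * (((size m : ℝ) + m j + α j + β + 2) *
        Real.Gamma (α j + m j + β + size m + 2)) := by
    rw [show α j + m j + 1 + β + ((size m + 1 : ℕ) : ℝ) + 2 =
      α j + m j + β + size m + 2 + 1 + 1 by push_cast; ring, Real.Gamma_add_one (by linarith),
      Real.Gamma_add_one hx.ne']
    ring
  have hΓ := (Real.Gamma_pos_of_pos hx).ne'
  have h2 : (size m : ℝ) + m j + α j + β + 2 ≠ 0 := by linarith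
  have h3 : (size m : ℝ) + m j + α j + β + 3 ≠ 0 := by linarith
  rw [g1, g2]
  field_simp

/-- Lowering `n i` loses only the orthogonality condition `k = n i - 1` for the weight `i`. Hence
the top moment for weight `j` sees only `P_{n - e_j}`. -/
theorem moment_poly_sub_single_eq_zero {n : Fin r → ℕ} {i j : Fin r} {k : ℕ}
    (hk : k < n j) (hij : i ≠ j ∨ k + 1 < n j) :
    moment β (α j + k) (poly hα hβ (n - Pi.single i 1)) = 0 := by
  refine (isTypeII_poly hα hβ _).moment_eq_zero ?_
  rcases eq_or_ne i j with rfl | h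
  · simp at hij ⊢
    omega
  · simpa [Pi.single_eq_of_ne h.symm] using hk

theorem size_sub_single_lt {n : Fin r → ℕ} {j : Fin r} (hj : n j ≠ 0) :
    size (n - Pi.single j 1) < size n := by
  obtain ⟨m, rfl⟩ := exists_eq_add_single hj
  rw [add_tsub_cancel_right, size_add_single]
  exact Nat.lt_succ_self _

theorem moment_sum_sub_single {n : Fin r → ℕ} {j : Fin r} (hj : n j ≠ 0) (c : Fin r → ℝ) :
    moment β (α j + (n j - 1 : ℕ)) (∑ i, if n i = 0 then 0 else
        C (c i) * poly hα hβ (n - Pi.single i 1)) =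
      c j * moment β (α j + (n j - 1 : ℕ)) (poly hα hβ (n - Pi.single j 1)) := by
  rw [moment_sum hβ (neg_one_lt_add_natCast (hα j) _), Finset.sum_eq_single j]
  · rw [if_neg hj, moment_C_mul]
  · intro i _ hij
    split_ifs with hi
    · exact moment_zero _ _
    · rw [moment_C_mul, moment_poly_sub_single_eq_zero hα hβ (by omega) (Or.inl hij), mul_zero]
  · simp

theorem isRecurrenceCoeff_poly
    (hαα : ∀ i j, i ≠ j → ∀ m : ℤ, α i - α j ≠ (m : ℝ))
    (n : Fin r → ℕ) :
    IsRecurrenceCoeff (poly hα hβ) n (aCoeff α β n)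
      fun k => (poly hα hβ n).nextCoeff - (poly hα hβ (n + Pi.single k 1)).nextCoeff := by
  refine ⟨fun j hj => if_pos hj, fun l => ?_⟩
  rw [← sub_eq_zero]
  set S := ∑ j, if n j = 0 then 0 else C (aCoeff α β n j) * poly hα hβ (n - Pi.single j 1)
    with hS
  have hdeg := (isTypeII_poly hα hβ n).natDegree_eq
  have hdeg' := (isTypeII_poly hα hβ (n + Pi.single l 1)).natDegree_eq
  rw [size_add_single] at hdeg'
  refine eq_zero_of_moments hα hβ hαα (n := n) ?_ fun j k hk => ?_
  -- Monicity cancels degree `|n| + 1`, and the choice of `b` cancels degree `|n|`.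
  · rw [degree_lt_iff_coeff_zero]
    intro M hM
    have hSM : S.coeff M = 0 := by
      rw [hS, finsetSum_coeff]
      refine Finset.sum_eq_zero fun j _ => ?_
      split_ifs with hj
      · simp
      · rw [coeff_C_mul, coeff_poly_of_lt hα hβ ((size_sub_single_lt hj).trans_le hM), mul_zero]
    rw [coeff_sub, coeff_add, coeff_add, hSM, coeff_C_mul, add_zero]
    rcases hM.eq_or_lt with rfl | hM
    · have h1 : (X * poly hα hβ n).coeff (size n) = (poly hα hβ n).nextCoeff := by
        rcases hN : size n with _ | N
        · rw [coeff_X_mul_zero, nextCoeff, if_pos (by omega)]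
        · rw [coeff_X_mul, nextCoeff_of_natDegree_pos (by omega), hdeg, hN, Nat.add_sub_cancel]
      have h2 : (poly hα hβ (n + Pi.single l 1)).coeff (size n) =
          (poly hα hβ (n + Pi.single l 1)).nextCoeff := by
        rw [nextCoeff_of_natDegree_pos (by omega), hdeg', Nat.add_sub_cancel]
      rw [h1, h2, coeff_poly_size]
      ring
    · obtain ⟨M, rfl⟩ := Nat.exists_eq_add_one_of_ne_zero (Nat.ne_of_gt (Nat.zero_lt_of_lt hM))
      rw [coeff_X_mul, coeff_poly_of_lt hα hβ hM]
      rcases (Nat.le_of_lt_succ hM).eq_or_lt with rfl | hM'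
      · rw [coeff_poly_size, ← size_add_single n l, coeff_poly_size]
        ring
      · rw [coeff_poly_of_lt hα hβ hM', coeff_poly_of_lt hα hβ (by rw [size_add_single]; omega)]
        ring
  · have hs := neg_one_lt_add_natCast (hα j) k
    have h1 : moment β (α j + k) (poly hα hβ (n + Pi.single l 1)) = 0 :=
      (isTypeII_poly hα hβ _).moment_eq_zero (hk.trans_le (by simp))
    rw [moment_sub hβ hs, moment_add hβ hs, moment_add hβ hs, moment_C_mul, h1,
      (isTypeII_poly hα hβ n).moment_eq_zero hk, moment_X_mul, mul_zero, zero_add, zero_add]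
    -- Multiplication by `x` turns `k` into `k + 1`, so only `k = n j - 1` is a genuine condition;
    -- it determines `a_{n,j}`.
    rcases Nat.lt_or_ge (k + 1) (n j) with hk' | hk'
    · have h2 := (isTypeII_poly hα hβ n).moment_eq_zero hk'
      push_cast at h2
      rw [add_assoc, h2, hS, moment_sum hβ hs, zero_sub, neg_eq_zero]
      refine Finset.sum_eq_zero fun i _ => ?_
      split_ifs with hi
      · exact moment_zero _ _
      · rw [moment_C_mul, moment_poly_sub_single_eq_zero hα hβ hk (Or.inr hk'), mul_zero]
    · have hj : n j ≠ 0 := by omega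
      obtain rfl : k = n j - 1 := by omega
      rw [hS, moment_sum_sub_single hα hβ hj]
      obtain ⟨m, rfl⟩ := exists_eq_add_single hj
      have h2 := moment_poly_add_single hα hβ hαα m j
      simp only [Pi.add_apply, Pi.single_eq_same, add_tsub_cancel_right]
      rw [h2, sub_self]

theorem IsRecurrenceCoeff.unique
    (hαα : ∀ i j, i ≠ j → ∀ m : ℤ, α i - α j ≠ (m : ℝ))
    {n : Fin r → ℕ} {a b a' b' : Fin r → ℝ}
    (h : IsRecurrenceCoeff (poly hα hβ) n a b) (h' : IsRecurrenceCoeff (poly hα hβ) n a' b') :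
    a = a' ∧ b = b' := by
  have hb : b = b' := by
    funext k
    have e := congrArg (fun p : ℝ[X] => p.coeff (size n)) ((h.recurrence k).symm.trans
      (h'.recurrence k))
    have hS (c : Fin r → ℝ) : (∑ j, if n j = 0 then 0 else
        C (c j) * poly hα hβ (n - Pi.single j 1)).coeff (size n) = 0 := by
      rw [finsetSum_coeff]
      refine Finset.sum_eq_zero fun j _ => ?_
      split_ifs with hj
      · simp
      · rw [coeff_C_mul, coeff_poly_of_lt hα hβ (size_sub_single_lt hj), mul_zero]
    simpa only [coeff_add, coeff_C_mul, hS, coeff_poly_size, mul_one, add_zero,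
      add_right_inj] using e
  refine ⟨funext fun j => ?_, hb⟩
  by_cases hj : n j = 0
  · rw [h.boundary j hj, h'.boundary j hj]
  have e := (h.recurrence j).symm.trans (h'.recurrence j)
  rw [hb] at e
  have e1 := congrArg (moment β (α j + (n j - 1 : ℕ))) (add_left_cancel e)
  rw [moment_sum_sub_single hα hβ hj, moment_sum_sub_single hα hβ hj] at e1
  refine mul_right_cancel₀ ?_ e1
  have := moment_poly_ne_zero hα hβ hαα (n - Pi.single j 1) j
  simpa using this

end recurrence

/-! ### Explicit formulas -/

theorem prod_div_eq_quot {r : ℕ} (α : Fin r → ℝ) (β : ℝ) (n : Fin r → ℕ) :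
    (∏ i, ((size n : ℝ) + α i + β) / ((size n : ℝ) + n i + α i + β)) =
      quot α n (-(size n : ℝ) - β) := by
  rw [quot, q, Q, eval_prod, eval_prod, ← Finset.prod_div_distrib]
  refine Finset.prod_congr rfl fun i _ => ?_
  rw [← neg_div_neg_eq]
  congr 1
  · simp
    ring
  · simp
    ring

theorem aCoeff_eq_aFormula {r : ℕ} {α : Fin r → ℝ} {β : ℝ} (hα : ∀ j, -1 < α j) (hβ : -1 < β)
    (hαα : ∀ i j, i ≠ j → ∀ m : ℤ, α i - α j ≠ (m : ℝ)) {n : Fin r → ℕ} (j : Fin r)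
    (h0 : ∀ i, (size n : ℝ) + n i + α i + β ≠ 0) (h2 : (size n : ℝ) + n j + α j + β - 1 ≠ 0) :
    aCoeff α β n j = aFormula α β n j := by
  by_cases hj : n j = 0
  · simp [aCoeff, aFormula, hj]
  have hK := eval_node_ne_zero hα hβ n
  have hz := eval_node_mul_eval_Q α n (-(size n : ℝ) - β)
  have hq : (∏ i, ((size n : ℝ) + α i + β) / ((size n : ℝ) + n i + α i + β)) =
      (node α n).eval (-(size n : ℝ) - β) / (node α n).eval (-(size n : ℝ) - β - 1) := by
    have hQ : (Q α n).eval (-(size n : ℝ) - β) ≠ 0 := by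
      rw [Q, eval_prod]
      refine Finset.prod_ne_zero_iff.2 fun i _ hi => h0 i ?_
      simp at hi
      linarith
    rw [(div_eq_div_iff hK hQ).2 hz, prod_div_eq_quot, quot]
  rw [aFormula, hq]
  obtain ⟨m, rfl⟩ := exists_eq_add_single hj
  have hne : (∏ i ∈ Finset.univ.erase j, ((m j : ℝ) + 1 - m i + α j - α i)) ≠ 0 := by
    refine Finset.prod_ne_zero_iff.2 fun i hi h => ?_
    refine add_natCast_ne hαα (Finset.ne_of_mem_erase hi) (m i) (m j + 1) ?_
    push_cast
    linarith
  have hs := eval_node_shift α m j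
  have hn := eval_node_add_ne_zero hαα m j
  have hp : (∏ i ∈ Finset.univ.erase j, ((((m + Pi.single j 1 : Fin r → ℕ) j : ℕ) : ℝ) + α j - α i)
      / ((((m + Pi.single j 1 : Fin r → ℕ) j : ℕ) : ℝ) - ((m + Pi.single j 1 : Fin r → ℕ) i : ℕ)
        + α j - α i)) =
      (node α (m + Pi.single j 1)).eval (α j + m j + 1) / (node α m).eval (α j + m j) /
        (m j + 1) := by
    rw [div_div, eq_div_iff (mul_ne_zero hn (by positivity))]
    rw [Finset.prod_div_distrib]
    have e : ∀ i ∈ Finset.univ.erase j, ((((m + Pi.single j 1 : Fin r → ℕ) j : ℕ) : ℝ)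
        - ((m + Pi.single j 1 : Fin r → ℕ) i : ℕ) + α j - α i) =
        (m j : ℝ) + 1 - m i + α j - α i := fun i hi => by
      simp [Pi.single_eq_of_ne (Finset.ne_of_mem_erase hi)]
    rw [Finset.prod_congr rfl e, div_mul_eq_mul_div, div_eq_iff hne, hs]
    simp only [Pi.add_apply, Pi.single_eq_same]
    push_cast
    ring
  rw [hp, aCoeff_add_single]
  have hK' := eval_node_ne_zero hα hβ m
  have hrm := (rising_pos hβ (size m)).ne'
  -- The zero gained from `m` to `n = m + e_j` contributes, up to sign, `|n| + n_j + α_j + β - 1`,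
  -- cancelling the last denominator of `aFormula`.
  have hnode : (node α (m + Pi.single j 1)).eval (-(size m : ℝ) - β - 1) =
      (node α m).eval (-(size m : ℝ) - β - 1) * -((size m : ℝ) + m j + α j + β + 1) := by
    rw [node_add_single, eval_mul]
    simp
    left
    ring
  have hk : kappa α β (m + Pi.single j 1) / kappa α β m =
      -(β + 1 + size m) * ((node α m).eval (-(size m : ℝ) - β - 1) /
        (node α (m + Pi.single j 1)).eval (-(size m : ℝ) - β - 1 - 1)) := by
    rw [size_add_single] at hK
    push_cast at hK
    rw [show -((size m : ℝ) + 1) - β = -(size m : ℝ) - β - 1 by ring] at hK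
    rw [kappa, kappa, size_add_single, rising_succ, pow_succ]
    push_cast
    rw [show -((size m : ℝ) + 1) - β = -(size m : ℝ) - β - 1 by ring]
    have : ((-1 : ℝ)) ^ size m ≠ 0 := pow_ne_zero _ (by norm_num)
    field_simp
  have h0j := h0 j
  rw [size_add_single] at h0j h2 ⊢
  simp only [Pi.add_apply, Pi.single_eq_same] at h0j h2 ⊢
  push_cast at h0j h2 ⊢
  have hmj : (0 : ℝ) ≤ m j := Nat.cast_nonneg _
  have hsm : (0 : ℝ) ≤ size m := Nat.cast_nonneg _
  have hαj := hα j
  have d1 : (size m : ℝ) + m j + α j + β + 1 ≠ 0 := fun h => h2 (by linarith)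
  have d2 : (size m : ℝ) + m j + α j + β + 2 ≠ 0 := fun h => h0j (by linarith)
  have d3 : (size m : ℝ) + m j + α j + β + 3 ≠ 0 := by linarith
  rw [hk, show -((size m : ℝ) + 1) - β = -(size m : ℝ) - β - 1 by ring, hnode,
    show (size m : ℝ) + 1 + (m j + 1) + α j + β + 1 = size m + m j + α j + β + 3 by ring,
    show (size m : ℝ) + 1 + (m j + 1) + α j + β - 1 = size m + m j + α j + β + 1 by ring,
    show (size m : ℝ) + 1 + (m j + 1) + α j + β = size m + m j + α j + β + 2 by ring]
  have hmj' : (m j : ℝ) + 1 ≠ 0 := by linarith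
  field_simp
  ring

/-- In this form a product over `Fin r ⊕ Fin 3` with one index removed splits along the sum type. -/
theorem prod_erase_eq_prod_ite {ι : Type*} [Fintype ι] [DecidableEq ι] (i : ι) (f : ι → ℝ) :
    ∏ j ∈ Finset.univ.erase i, f j = ∏ j, if j = i then 1 else f j := by
  rw [← Finset.prod_erase (a := i) Finset.univ (f := fun j => if j = i then 1 else f j)
    (if_pos rfl)]
  exact Finset.prod_congr rfl fun j hj => (if_neg (Finset.ne_of_mem_erase hj)).symm

/-- The divided difference of a polynomial `F` of degree at most `r + 1` at the `r + 3` nodes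
`x j`, `z + 1`, `z`, `z - 1` vanishes. -/
theorem sum_div_prod_sub_mul {r : ℕ} {x : Fin r → ℝ} (hx : Function.Injective x) {z : ℝ}
    (h1 : ∀ i, z + 1 - x i ≠ 0) (h2 : ∀ i, z - x i ≠ 0) (h3 : ∀ i, z - 1 - x i ≠ 0)
    {F : ℝ[X]} (hF : F.natDegree ≤ r + 1) :
    ∑ j, F.eval (x j) / ((∏ i ∈ Finset.univ.erase j, (x j - x i)) *
        ((x j - (z + 1)) * (x j - z) * (x j - (z - 1)))) =
      -(1 / 2) * (F.eval (z + 1) / ∏ i, (z + 1 - x i) - 2 * (F.eval z / ∏ i, (z - x i)) +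
        F.eval (z - 1) / ∏ i, (z - 1 - x i)) := by
  let v : Fin r ⊕ Fin 3 → ℝ := Sum.elim x ![z + 1, z, z - 1]
  have hv : Function.Injective v := by
    refine hx.sumElim ?_ ?_
    · intro a b hab
      fin_cases a <;> fin_cases b <;> simp at hab ⊢ <;> linarith
    · intro i k hk
      fin_cases k <;> simp at hk
      · exact h1 i (by linarith)
      · exact h2 i (by linarith)
      · exact h3 i (by linarith)
  have hc : (Finset.univ : Finset (Fin r ⊕ Fin 3)).card = r + 3 := by simp
  have hd : F.degree < ((r + 2 : ℕ) : WithBot ℕ) :=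
    degree_le_natDegree.trans_lt (by exact_mod_cast Nat.lt_succ_of_le hF)
  -- Lagrange interpolation writes the coefficient of `X ^ (r + 2)`, here zero, as the divided
  -- difference. The nodes `z + 1`, `z`, `z - 1` contribute the weights `1/2`, `-1`, `1/2`, hence
  -- the second difference.
  have h := Lagrange.coeff_eq_sum (s := Finset.univ) (v := v) hv.injOn (P := F)
    (hd.trans_le (by rw [hc]; exact_mod_cast Nat.le_succ _))
  rw [hc, coeff_eq_zero_of_natDegree_lt (by omega), Fintype.sum_sum_type] at h
  simp only [prod_erase_eq_prod_ite, Fintype.prod_sum_type, Fin.sum_univ_three,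
    Fin.prod_univ_three] at h
  simp [v] at h
  simp only [prod_erase_eq_prod_ite]
  rw [div_neg, div_mul_eq_div_div, div_mul_eq_div_div] at h
  linear_combination -h

theorem eval_Q {r : ℕ} (α : Fin r → ℝ) (n : Fin r → ℕ) (z : ℝ) :
    (Q α n).eval z = ∏ i, (z - (n i + α i)) := by
  simp [Q, eval_prod]

theorem eval_Q_ne_zero_iff {r : ℕ} {α : Fin r → ℝ} {n : Fin r → ℕ} {z : ℝ} :
    (Q α n).eval z ≠ 0 ↔ ∀ i, z - (n i + α i) ≠ 0 := by
  simp [eval_Q, Finset.prod_ne_zero_iff]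

theorem natDegree_X_mul_q_le {r : ℕ} (α : Fin r → ℝ) : (X * q α).natDegree ≤ r + 1 := by
  refine natDegree_mul_le.trans ?_
  rw [q, natDegree_finsetProd_X_sub_C_eq_card, natDegree_X, Finset.card_univ, Fintype.card_fin,
    add_comm]

/-- Up to the common factor `(|n| + β) q(z₀) / Q(z₀)`, `a_{n,j}` is the term at the node `n j + α j`
in the divided difference of `z q(z)`. -/
theorem sum_aFormula {r : ℕ} {α : Fin r → ℝ} {β : ℝ}
    (hαα : ∀ i j, i ≠ j → ∀ m : ℤ, α i - α j ≠ (m : ℝ)) {n : Fin r → ℕ}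
    (h0 : (Q α n).eval (-(size n : ℝ) - β) ≠ 0)
    (h1 : (Q α n).eval (-(size n : ℝ) - β - 1) ≠ 0)
    (h2 : (Q α n).eval (-(size n : ℝ) - β + 1) ≠ 0) :
    ∑ j, aFormula α β n j = sumFormula α β n := by
  have hx : Function.Injective fun j => (n j : ℝ) + α j := fun i j hij => by
    by_contra h
    exact add_natCast_ne hαα h (n i) (n j) (by simpa only [add_comm] using hij)
  have h := sum_div_prod_sub_mul hx (eval_Q_ne_zero_iff.1 h2) (eval_Q_ne_zero_iff.1 h0)
    (eval_Q_ne_zero_iff.1 h1) (natDegree_X_mul_q_le α)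
  simp only [← eval_Q, eval_mul, eval_X] at h
  rw [sumFormula, secondDiff]
  simp only [quot] at h ⊢
  simp only [← mul_div_assoc] at h ⊢
  rw [← h, Finset.mul_sum]
  refine Finset.sum_congr rfl fun j _ => ?_
  have hq : (q α).eval ((n j : ℝ) + α j) =
      n j * ∏ i ∈ Finset.univ.erase j, ((n j : ℝ) + α j - α i) := by
    rw [q, eval_prod, ← Finset.mul_prod_erase _ _ (Finset.mem_univ j)]
    simp
  have hp : ∏ i ∈ Finset.univ.erase j, ((n j : ℝ) - n i + α j - α i) =
      ∏ i ∈ Finset.univ.erase j, ((n j : ℝ) + α j - (n i + α i)) :=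
    Finset.prod_congr rfl fun i _ => by ring
  rw [aFormula, prod_div_eq_quot, quot, Finset.prod_div_distrib, hp, hq,
    show (n j : ℝ) + α j - (-(size n : ℝ) - β + 1) = size n + n j + α j + β - 1 by ring,
    show (n j : ℝ) + α j - (-(size n : ℝ) - β) = size n + n j + α j + β by ring,
    show (n j : ℝ) + α j - (-(size n : ℝ) - β - 1) = size n + n j + α j + β + 1 by ring]
  generalize (size n : ℝ) + n j + α j + β + 1 = u
  generalize (size n : ℝ) + n j + α j + β - 1 = v
  generalize (size n : ℝ) + n j + α j + β = w
  generalize ∏ i ∈ Finset.univ.erase j, ((n j : ℝ) + α j - (n i + α i)) = D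
  ring

/-! ### Dependence on the parameter `β` -/

theorem eventually_add_ne_zero (β c : ℝ) : ∀ᶠ β' in 𝓝[≠] β, c + β' ≠ 0 := by
  rcases eq_or_ne (-c) β with h | h
  · filter_upwards [self_mem_nhdsWithin] with x hx hc
    exact hx (by rw [Set.mem_singleton_iff]; linarith)
  · filter_upwards [nhdsWithin_le_nhds (isOpen_ne.mem_nhds h.symm)] with x hx hc
    exact hx (by linarith)

theorem eventually_eval_Q_ne_zero {r : ℕ} (α : Fin r → ℝ) (β c : ℝ) (n : Fin r → ℕ) :
    ∀ᶠ β' in 𝓝[≠] β, (Q α n).eval (-(size n : ℝ) - β' + c) ≠ 0 := by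
  simp only [eval_Q_ne_zero_iff, eventually_all]
  intro i
  filter_upwards [eventually_add_ne_zero β (size n - c + (n i + α i))] with x hx h
  exact hx (by linarith)

theorem eventually_neg_one_lt {β : ℝ} (hβ : -1 < β) : ∀ᶠ β' in 𝓝[≠] β, -1 < β' :=
  nhdsWithin_le_nhds (lt_mem_nhds hβ)

theorem continuousAt_delta {r : ℕ} {α : Fin r → ℝ} {β : ℝ} (hα : ∀ j, -1 < α j) (hβ : -1 < β)
    (n : Fin r → ℕ) : ContinuousAt (fun β' => delta α β' n) β := by
  have h := eval_node_ne_zero hα hβ n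
  have h1 : Continuous fun β' : ℝ => (node α n).eval (-(size n : ℝ) - β') := by fun_prop
  have h2 : Continuous fun β' : ℝ => (node α n).eval (-(size n : ℝ) - β' - 1) := by fun_prop
  unfold delta
  exact ((continuous_const.add continuous_id).neg.continuousAt.mul
    (h1.continuousAt.div h2.continuousAt h)).add continuousAt_id

theorem continuousAt_kappa {r : ℕ} {α : Fin r → ℝ} {β : ℝ} (hα : ∀ j, -1 < α j) (hβ : -1 < β)
    (n : Fin r → ℕ) : ContinuousAt (fun β' => kappa α β' n) β := by
  have h := eval_node_ne_zero hα hβ n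
  have h1 : Continuous fun β' : ℝ => rising β' (size n) := by
    unfold rising
    fun_prop
  have h2 : Continuous fun β' : ℝ => (node α n).eval (-(size n : ℝ) - β' - 1) := by fun_prop
  unfold kappa
  exact (continuous_const.mul h1).continuousAt.div h2.continuousAt h

theorem continuousAt_aCoeff {r : ℕ} {α : Fin r → ℝ} {β : ℝ} (hα : ∀ j, -1 < α j) (hβ : -1 < β)
    (n : Fin r → ℕ) (j : Fin r) : ContinuousAt (fun β' => aCoeff α β' n j) β := by
  by_cases hj : n j = 0
  · simp only [aCoeff, if_pos hj]
    exact continuousAt_const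
  simp only [aCoeff, if_neg hj]
  -- With `n j ≥ 1` also `|n| ≥ 1`, so the linear denominators are positive.
  have hnj : (1 : ℝ) ≤ n j := by exact_mod_cast Nat.one_le_iff_ne_zero.2 hj
  have hN : (n j : ℝ) ≤ size n := by exact_mod_cast le_size n j
  have hαj := hα j
  have h1 : (size n : ℝ) + n j + α j + β ≠ 0 := by linarith
  have h2 : (size n : ℝ) + n j + α j + β + 1 ≠ 0 := by linarith
  refine (((continuousAt_kappa hα hβ n).div (continuousAt_kappa hα hβ _)
    (kappa_ne_zero hα hβ _)).mul continuousAt_const).mul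
    (continuousAt_const.div ?_ (mul_ne_zero h1 h2))
  fun_prop

theorem eventually_aCoeff_eq {r : ℕ} {α : Fin r → ℝ} {β : ℝ} (hα : ∀ j, -1 < α j) (hβ : -1 < β)
    (hαα : ∀ i j, i ≠ j → ∀ m : ℤ, α i - α j ≠ (m : ℝ)) (n : Fin r → ℕ) (j : Fin r) :
    ∀ᶠ β' in 𝓝[≠] β, aCoeff α β' n j = aFormula α β' n j := by
  have h0 : ∀ᶠ β' in 𝓝[≠] β, ∀ i, (size n : ℝ) + n i + α i + β' ≠ 0 :=
    eventually_all.2 fun i => eventually_add_ne_zero β _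
  filter_upwards [eventually_neg_one_lt hβ, h0,
    eventually_add_ne_zero β ((size n : ℝ) + n j + α j - 1)] with x hx h0 h1
  exact aCoeff_eq_aFormula hα hx hαα j h0 fun h => h1 (by linarith)

theorem tendsto_aFormula {r : ℕ} {α : Fin r → ℝ} {β : ℝ} (hα : ∀ j, -1 < α j) (hβ : -1 < β)
    (hαα : ∀ i j, i ≠ j → ∀ m : ℤ, α i - α j ≠ (m : ℝ)) (n : Fin r → ℕ) (j : Fin r) :
    Tendsto (fun β' => aFormula α β' n j) (𝓝[≠] β) (𝓝 (aCoeff α β n j)) :=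
  ((continuousAt_aCoeff hα hβ n j).tendsto.mono_left nhdsWithin_le_nhds).congr'
    (eventually_aCoeff_eq hα hβ hαα n j)

theorem tendsto_deltaFormula {r : ℕ} {α : Fin r → ℝ} {β : ℝ} (hα : ∀ j, -1 < α j) (hβ : -1 < β)
    (n : Fin r → ℕ) :
    Tendsto (fun β' => deltaFormula α β' n) (𝓝[≠] β) (𝓝 (delta α β n)) := by
  refine ((continuousAt_delta hα hβ n).tendsto.mono_left nhdsWithin_le_nhds).congr' ?_
  filter_upwards [eventually_neg_one_lt hβ, eventually_eval_Q_ne_zero α β 0 n] with x hx hQ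
  exact delta_eq_deltaFormula hα hx (by simpa using hQ)

theorem tendsto_sumFormula {r : ℕ} {α : Fin r → ℝ} {β : ℝ} (hα : ∀ j, -1 < α j) (hβ : -1 < β)
    (hαα : ∀ i j, i ≠ j → ∀ m : ℤ, α i - α j ≠ (m : ℝ)) (n : Fin r → ℕ) :
    Tendsto (fun β' => sumFormula α β' n) (𝓝[≠] β) (𝓝 (∑ j, aCoeff α β n j)) := by
  refine (tendsto_finsetSum Finset.univ fun j _ => tendsto_aFormula hα hβ hαα n j).congr' ?_
  filter_upwards [eventually_eval_Q_ne_zero α β 0 n, eventually_eval_Q_ne_zero α β (-1) n,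
    eventually_eval_Q_ne_zero α β 1 n] with x h0 h1 h2
  exact sum_aFormula hαα (by simpa using h0) (by simpa [sub_eq_add_neg] using h1) h2

end JacobiPineiro
end

theorem mainTheorem8 (r : ℕ) (α : Fin r → ℝ) (β : ℝ)
    (hα : ∀ j, -1 < α j) (hβ : -1 < β)
    (hαα : ∀ i j, i ≠ j → ∀ m : ℤ, α i - α j ≠ (m : ℝ)) :
    ∃ (P : (Fin r → ℕ) → ℝ[X]) (a b : (Fin r → ℕ) → Fin r → ℝ),
      -- `P n` is the unique type II polynomial of multi-index `n`
      (∀ n p, JacobiPineiro.IsTypeII α β n p ↔ p = P n) ∧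
      -- `a n`, `b n` are the unique recurrence coefficients at `n`
      (∀ n a' b', JacobiPineiro.IsRecurrenceCoeff P n a' b' ↔ a' = a n ∧ b' = b n) ∧
      -- the coefficients `a_{n,j}`; the second clause covers the parameters at which the
      -- formula reads `0 / 0`
      (∀ n j,
        ((∀ i, (JacobiPineiro.size n : ℝ) + n i + α i + β ≠ 0) →
          (JacobiPineiro.size n : ℝ) + n j + α j + β + 1 ≠ 0 →
          (JacobiPineiro.size n : ℝ) + n j + α j + β - 1 ≠ 0 →
          a n j = JacobiPineiro.aFormula α β n j) ∧
        Tendsto (fun β' => JacobiPineiro.aFormula α β' n j) (𝓝[≠] β) (𝓝 (a n j))) ∧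
      -- the subleading coefficient `δ_n` of `P n`
      (∀ n,
        ((JacobiPineiro.Q α n).eval (-(JacobiPineiro.size n : ℝ) - β) ≠ 0 →
          (P n).nextCoeff = JacobiPineiro.deltaFormula α β n) ∧
        Tendsto (fun β' => JacobiPineiro.deltaFormula α β' n) (𝓝[≠] β) (𝓝 (P n).nextCoeff)) ∧
      -- the coefficients `b_{n,k}`
      (∀ n k, b n k = (P n).nextCoeff - (P (n + Pi.single k 1)).nextCoeff) ∧
      -- the sum of the `a_{n,j}`
      (∀ n,
        ((JacobiPineiro.Q α n).eval (-(JacobiPineiro.size n : ℝ) - β) ≠ 0 →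
          (JacobiPineiro.Q α n).eval (-(JacobiPineiro.size n : ℝ) - β - 1) ≠ 0 →
          (JacobiPineiro.Q α n).eval (-(JacobiPineiro.size n : ℝ) - β + 1) ≠ 0 →
          ∑ j, a n j = JacobiPineiro.sumFormula α β n) ∧
        Tendsto (fun β' => JacobiPineiro.sumFormula α β' n) (𝓝[≠] β) (𝓝 (∑ j, a n j))) := by
  refine ⟨JacobiPineiro.poly hα hβ, JacobiPineiro.aCoeff α β,
    fun n k => (JacobiPineiro.poly hα hβ n).nextCoeff -
      (JacobiPineiro.poly hα hβ (n + Pi.single k 1)).nextCoeff, fun n p => ⟨fun h => ?_, ?_⟩,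
    fun n a' b' => ⟨fun h => ?_, ?_⟩, fun n j => ⟨fun h0 _ h2 => ?_, ?_⟩,
    fun n => ⟨fun hQ => ?_, ?_⟩,
    fun n k => rfl, fun n => ⟨fun h0 h1 h2 => ?_, ?_⟩⟩
  · exact h.unique hα hβ hαα (JacobiPineiro.isTypeII_poly hα hβ n)
  · rintro rfl
    exact JacobiPineiro.isTypeII_poly hα hβ n
  · exact h.unique hα hβ hαα (JacobiPineiro.isRecurrenceCoeff_poly hα hβ hαα n)
  · rintro ⟨rfl, rfl⟩
    exact JacobiPineiro.isRecurrenceCoeff_poly hα hβ hαα n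
  · exact JacobiPineiro.aCoeff_eq_aFormula hα hβ hαα j h0 h2
  · exact JacobiPineiro.tendsto_aFormula hα hβ hαα n j
  · rw [JacobiPineiro.nextCoeff_poly]
    exact JacobiPineiro.delta_eq_deltaFormula hα hβ hQ
  · rw [JacobiPineiro.nextCoeff_poly]
    exact JacobiPineiro.tendsto_deltaFormula hα hβ n
  · rw [← JacobiPineiro.sum_aFormula hαα h0 h1 h2]
    refine Finset.sum_congr rfl fun j _ => ?_
    refine JacobiPineiro.aCoeff_eq_aFormula hα hβ hαα j (fun i hi => ?_) fun hj => ?_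
    · exact JacobiPineiro.eval_Q_ne_zero_iff.1 h0 i (by linarith)
    · exact JacobiPineiro.eval_Q_ne_zero_iff.1 h2 j (by linarith)
  · exact JacobiPineiro.tendsto_sumFormula hα hβ hαα n
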